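/- **Conventions.** Let $\mathbb{R}_{\max}=\mathbb{R}\cup\{\varepsilon\}$, $\varepsilon=-\infty$, with $a\oplus b=\max\{a,b\}$, $a\otimes b=a+b$ and the order topology; matrix and vector operations are the induced ones, $\mathcal{E}$ is the vector with all entries $\varepsilon$, and $E_n$ is the max-plus unit matrix. Let $A=(a_{ij})\in\mathbb{R}_{\max}^{n\times n}$, $\det A=\bigoplus_{\pi\in S_n}\bigotimes_i a_{i\pi(i)}$ and $\chi_A(t)=\det(A\oplus t\otimes E_n)$. The *algebraic eigenvalues* of $A$ are the roots of $\chi_A$, i.e. the $r_i\in\mathbb{R}_{\max}$ in the factorization $\chi_A(t)=c\otimes\bigotimes_i (t\oplus r_i)$ with $c\ne\varepsilon$. $G(A)$ is the digraph on $\{1,\dots,n\}$ with an edge $(i,j)$ of weight $a_{ij}$ whenever $a_{ij}\neq\varepsilon$. A *multi-circuit* $\mathcal{C}$ is a (possibly empty) union of vertex-disjoint elementary circuits of $G(A)$ (loops allowed), with vertex set $V(\mathcal{C})$, edge set $E(\mathcal{C})$, length $\ell(\mathcal{C})$ (number of edges) and weight $w(\mathcal{C})$ (sum of edge weights). For $\lambda\in\mathbb{R}$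 it is *$\lambda$-maximal* if $\chi_A(\lambda)=w(\mathcal{C})\otimes\lambda^{\otimes(n-\ell(\mathcal{C}))}$; it is *$\varepsilon$-maximal* if it is $\mu$-maximal for all sufficiently small real $\mu$. $A$ satisfies $(\bigstar)$ if for each $\lambda\in\mathbb{R}_{\max}$ any two distinct $\lambda$-maximal multi-circuits in $G(A)$ have different lengths. Let $A_{\mathcal{C}}$ (resp. $A_{\setminus\mathcal{C}}$) be $A$ with all entries outside (resp. in) $E(\mathcal{C})$ replaced by $\varepsilon$, let $E_{\mathcal{C}}$ (resp. $E_{\setminus\mathcal{C}}$) be the matrix with entries $0$ at the diagonal positions $i\in V(\mathcal{C})$ (resp. $i\notin V(\mathcal{C})$) and $\varepsilon$ elsewhere, and $$W(A,\lambda,\mathcal{C})=\{x\in\mathbb{R}_{\max}^n : (A_{\setminus\mathcal{C}}\oplus\lambda\otimes E_{\mathcal{C}})\otimes x=(A_{\mathcal{C}}\oplus\lambda\otimes E_{\setminus\mathcal{C}})\otimes x\}.$$ For $\zeta\in[0,1]^{n\times n}$ and $\delta>0$ let $A(\zeta;\delta)=(a_{ij}-\zeta_{ij}\delta)_{ij}$,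 and let $Z$ be the set of those $\zeta\in[0,1]^{n\times n}$ for which there is $\delta'>0$ such that $A(\zeta;\delta)$ satisfies $(\bigstar)$ for all $0<\delta<\delta'$. Put $\mathcal{B}(\lambda,r)=[\lambda-r,\lambda+r]$ for $\lambda\in\mathbb{R}$ and $\mathcal{B}(\varepsilon,r)=\{\varepsilon\}$. Define $$W(A,\lambda)=\bigcap_{\zeta\in Z}\ \lim_{\delta\to+0}\ \bigoplus_{\lambda'\in\mathcal{B}(\lambda,n\delta)}W\bigl(A(\zeta;\delta),\lambda',\mathcal{C}_{\lambda'}(\zeta;\delta)\bigr),$$ where $\mathcal{C}_{\lambda'}(\zeta;\delta)$ is a $\lambda'$-maximal multi-circuit in $G(A(\zeta;\delta))$ (under $(\bigstar)$ its choice does not matter), $\bigoplus_{\lambda'}$ denotes the set of all finite max-plus sums of vectors of these spaces, and $\lim_{\delta\to+0}S(\delta)$ is the set of all $x$ such that there are $x(\delta)\in S(\delta)$, $\delta>0$, with $x(\delta)\to x$ as $\delta\to+0$. The *algebraic eigenvectors* of $A$ with respect to an algebraic eigenvalue $\lambda$ are the vectors $x\neq\mathcal{E}$ in $W(A,\lambda)$.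 **Theorem.** Let $A\in\mathbb{R}_{\max}^{n\times n}$ be symmetric ($a_{ij}=a_{ji}$ for all $i,j$), and let $\lambda\neq\mu$ be algebraic eigenvalues of $A$ in $\mathbb{R}_{\max}$. Let $x$ and $y$ be algebraic eigenvectors of $A$ with respect to $\lambda$ and $\mu$, respectively. Then $x$ and $y$ are orthogonal: the maximum in $\bigoplus_{i=1}^n x_i\otimes y_i$ is attained for at least two distinct indices $i$. -/

import Mathlib

open Filter Topology

namespace MaxPlus

/-- The max-plus semiring `ℝ ∪ {-∞}`: `⊥` is the max-plus zero `ε`, the max-plus addition is `⊔`,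
the max-plus multiplication is `+` (with `⊥ + a = ⊥`), and the max-plus unit is `0`.
The topology is the order topology. -/
abbrev Rmax : Type := WithBot ℝ

/-- Max-plus column vectors. The max-plus zero vector is `⊥`, the max-plus sum of vectors is `⊔`. -/
abbrev Vec (n : ℕ) : Type := Fin n → Rmax

/-- Square max-plus matrices. The entrywise max-plus sum of matrices is `⊔`. -/
abbrev Mat (n : ℕ) : Type := Fin n → Fin n → Rmax

variable {n : ℕ}

/-- The max-plus matrix-vector product `A ⊗ x`. -/
noncomputable def mulVec (A : Mat n) (x : Vec n) : Vec n :=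
  fun i => Finset.univ.sup fun j => A i j + x j

/-- The max-plus scalar multiple `t ⊗ A`. -/
noncomputable def smul (t : Rmax) (A : Mat n) : Mat n := fun i j => t + A i j

/-- The max-plus diagonal matrix with entry `0` at the positions in `S` and `ε` elsewhere. -/
noncomputable def diagOn (S : Finset (Fin n)) : Mat n :=
  fun i j => if i = j ∧ i ∈ S then 0 else ⊥

/-- The max-plus unit matrix. -/
noncomputable def unitMat : Mat n := diagOn Finset.univ

/-- The max-plus determinant. -/
noncomputable def det (A : Mat n) : Rmax :=
  Finset.univ.sup fun π : Equiv.Perm (Fin n) => ∑ i, A i (π i)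

/-- The characteristic polynomial `t ↦ det (A ⊕ t ⊗ E)`, as a function. -/
noncomputable def charPoly (A : Mat n) (t : Rmax) : Rmax := det (A ⊔ smul t unitMat)

/-- `r` is a root of the max-plus polynomial function `f`: it occurs in the factorization
`f(t) = c ⊗ (t ⊕ r₁) ⊗ ⋯ ⊗ (t ⊕ rₘ)` with `c ≠ ε`. -/
def IsRoot (f : Rmax → Rmax) (r : Rmax) : Prop :=
  ∃ (c : Rmax) (s : Multiset Rmax), c ≠ ⊥ ∧
    (∀ t, f t = c + (s.map fun a => t ⊔ a).sum) ∧ r ∈ s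

/-- Algebraic eigenvalues are the roots of the characteristic polynomial. -/
def IsAlgEigenvalue (A : Mat n) (lam : Rmax) : Prop := IsRoot (charPoly A) lam

/-- A multi-circuit (a union of vertex-disjoint elementary circuits, loops allowed, possibly empty)
in the complete digraph on `Fin n`. It is given by its vertex set `verts` and the
permutation `succ` that sends each vertex to the succeeding one and fixes all other points: the
circuits are the cycles of `succ` on `verts`, a fixed point of `succ` in `verts` being a loop. -/
@[ext]
structure MultiCircuit (n : ℕ) where
  verts : Finset (Fin n)
  succ : Equiv.Perm (Fin n)
  succ_eq_self : ∀ i, i ∉ verts → succ i = i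

namespace MultiCircuit

/-- `(i, j)` is an edge of the multi-circuit. -/
def IsEdge (C : MultiCircuit n) (i j : Fin n) : Prop := i ∈ C.verts ∧ C.succ i = j

instance (C : MultiCircuit n) (i j : Fin n) : Decidable (C.IsEdge i j) :=
  inferInstanceAs (Decidable (i ∈ C.verts ∧ C.succ i = j))

/-- The multi-circuit lies in the digraph `G(A)`, whose edges are the `(i, j)` with `a_ij ≠ ε`. -/
def InGraph (A : Mat n) (C : MultiCircuit n) : Prop := ∀ i j, C.IsEdge i j → A i j ≠ ⊥

/-- The length (number of edges). -/
def length (C : MultiCircuit n) : ℕ := C.verts.card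

/-- The weight (sum of the weights of the edges). -/
noncomputable def weight (A : Mat n) (C : MultiCircuit n) : Rmax := ∑ i ∈ C.verts, A i (C.succ i)

/-- `C` is a `lam`-maximal multi-circuit in `G(A)`, for a real number `lam`. -/
def IsMaximalReal (A : Mat n) (lam : ℝ) (C : MultiCircuit n) : Prop :=
  C.InGraph A ∧ charPoly A (lam : Rmax) = C.weight A + (n - C.length) • (lam : Rmax)

/-- `C` is a `lam`-maximal multi-circuit in `G(A)`, for `lam` in `ℝ ∪ {-∞}`; for `lam = ε`, this means
`m`-maximal for all sufficiently small real `m`. -/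
def IsMaximal (A : Mat n) (lam : Rmax) (C : MultiCircuit n) : Prop :=
  (∃ l : ℝ, lam = (l : Rmax) ∧ C.IsMaximalReal A l) ∨
    (lam = ⊥ ∧ ∃ M : ℝ, ∀ m : ℝ, m ≤ M → C.IsMaximalReal A m)

/-- The matrix `A_C`: the entries of `A` on the edges of `C`, and `ε` elsewhere. -/
noncomputable def matOn (A : Mat n) (C : MultiCircuit n) : Mat n :=
  fun i j => if C.IsEdge i j then A i j else ⊥

/-- The matrix `A_{∖C}`: the entries of `A` off the edges of `C`, and `ε` elsewhere. -/
noncomputable def matOff (A : Mat n) (C : MultiCircuit n) : Mat n :=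
  fun i j => if C.IsEdge i j then ⊥ else A i j

end MultiCircuit

/-- `W(A, lam, C)`: the solutions of
`(A_{∖C} ⊕ lam ⊗ E_C) ⊗ x = (A_C ⊕ lam ⊗ E_{∖C}) ⊗ x`. -/
def circuitSpace (A : Mat n) (lam : Rmax) (C : MultiCircuit n) : Set (Vec n) :=
  {x | mulVec (C.matOff A ⊔ smul lam (diagOn C.verts)) x =
    mulVec (C.matOn A ⊔ smul lam (diagOn C.vertsᶜ)) x}

/-- For each `lam` in `ℝ ∪ {-∞}`, distinct `lam`-maximal multi-circuits have different lengths. -/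
def DistinctLengths (A : Mat n) : Prop :=
  ∀ (lam : Rmax) (C C' : MultiCircuit n), C.IsMaximal A lam → C'.IsMaximal A lam → C ≠ C' →
    C.length ≠ C'.length

/-- The perturbed matrix `A(ζ; δ)`, with entries `a_ij - ζ_ij δ`. -/
noncomputable def perturb (A : Mat n) (ζ : Fin n → Fin n → ℝ) (δ : ℝ) : Mat n :=
  fun i j => A i j + ((-(ζ i j * δ) : ℝ) : Rmax)

/-- The set `Z` of the admissible perturbation directions of `A`. -/
def admissible (A : Mat n) : Set (Fin n → Fin n → ℝ) :=
  {ζ | (∀ i j, ζ i j ∈ Set.Icc (0 : ℝ) 1) ∧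
    ∃ δ' : ℝ, 0 < δ' ∧ ∀ δ : ℝ, 0 < δ → δ < δ' → DistinctLengths (perturb A ζ δ)}

/-- `[lam - r, lam + r]` for real `lam`, and `{ε}` for `lam = ε`. -/
def closedInterval (lam : Rmax) (r : ℝ) : Set Rmax :=
  {m | (lam = ⊥ ∧ m = ⊥) ∨
    ∃ l k : ℝ, lam = (l : Rmax) ∧ m = (k : Rmax) ∧ k ∈ Set.Icc (l - r) (l + r)}

/-- The max-plus sum, over `m ∈ closedInterval lam r`, of the spaces `W(B, m, C_m)`, with
`C_m` an `m`-maximal multi-circuit in `G(B)`: all finite max-plus sums of vectors from these spaces.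
(If `DistinctLengths B`, then `W(B, m, C_m)` does not depend on the choice of `C_m`.) -/
def sumSpace (B : Mat n) (lam : Rmax) (r : ℝ) : Set (Vec n) :=
  {x | ∃ (s : Finset Rmax) (v : Rmax → Vec n),
    (∀ m ∈ s, m ∈ closedInterval lam r ∧
      ∃ C : MultiCircuit n, C.IsMaximal B m ∧ v m ∈ circuitSpace B m C) ∧
    x = s.sup v}

/-- The limit, as `δ → +0`, of a family of sets of max-plus vectors. -/
def limSet (S : ℝ → Set (Vec n)) : Set (Vec n) :=
  {x | ∃ u : ℝ → Vec n, (∀ δ, 0 < δ → u δ ∈ S δ) ∧ Tendsto u (𝓝[>] 0) (𝓝 x)}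

/-- The algebraic eigenspace `W(A, lam)`. -/
def algEigenspace (A : Mat n) (lam : Rmax) : Set (Vec n) :=
  ⋂ ζ ∈ admissible A, limSet fun δ => sumSpace (perturb A ζ δ) lam (n * δ)

/-- `x` is an algebraic eigenvector of `A` with respect to `lam`. -/
def IsAlgEigenvector (A : Mat n) (lam : Rmax) (x : Vec n) : Prop :=
  x ∈ algEigenspace A lam ∧ x ≠ ⊥

/-- Tropical orthogonality: the maximum in `⨁ᵢ xᵢ ⊗ yᵢ` is attained at least twice. -/
def Orthogonal (x y : Vec n) : Prop :=
  ∃ i j : Fin n, i ≠ j ∧ (∀ k, x k + y k ≤ x i + y i) ∧ (∀ k, x k + y k ≤ x j + y j)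

end MaxPlus

/-! This is the max-plus form of the fact that left and right eigenvectors for different eigenvalues
are orthogonal. Choose a generic direction ζ that is admissible together with its transpose. As A is
symmetric, perturbing along the transpose of ζ gives the transpose of B = A(ζ;δ), so y is
approximated by sums of left eigenvectors of B and x by sums of right ones. `NoStrictMax` survives
sums and limits, hence it suffices to treat one vector of each kind, with parameters μ < λ
(`noStrictMax_of_lt`).

Suppose that x_i ⊗ y_i has a strict maximum at i₀, and let M be the maximum of y_i ⊗ b_ij ⊗ x_j.
Call the entries equal to M tight. The diagonal terms are too small to matter, except possibly in
row i₀, so every tight column, and every tight row other than i₀, contains a tight edge of its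
multi-circuit and a second tight entry (`tight_of_mem_circuitSpace`). Comparing the numbers of tight
rows and columns, one of the two multi-circuits can be rerouted along tight entries without changing
length or weight (`not_exists_tight_exchange`), which contradicts (★). -/

namespace MaxPlus

variable {n : ℕ}

/-! ### Exchanging edges of a maximal multi-circuit -/

/-- A fixed-point-free self-map of a nonempty finite set agrees on some nonempty set with a
nontrivial permutation that fixes all other points. -/
theorem exists_perm_of_mapsTo {α : Type*} [Finite α] (R : Finset α) (hR : R.Nonempty) (h : α → α)
    (hmaps : ∀ i ∈ R, h i ∈ R) (hne : ∀ i ∈ R, h i ≠ i) :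
    ∃ σ : Equiv.Perm α, σ ≠ 1 ∧ ∀ i, σ i ≠ i → i ∈ R ∧ σ i = h i := by
  classical
  -- A self-map is bijective on its periodic points, so σ can follow `h` on those lying in `R`; an
  -- orbit starting in `R` reaches one by finiteness.
  have hbij := Function.bijOn_periodicPts h
  set P := Function.periodicPts h
  have hmem : ∀ i ∈ P, h i ∈ P := fun i hi => hbij.mapsTo hi
  let S : Set α := P ∩ R
  have hSS : ∀ i ∈ S, h i ∈ S := fun i hi => ⟨hmem i hi.1, hmaps i hi.2⟩
  let f : α → α := fun i => if i ∈ S then h i else i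
  have hinj : Function.Injective f := by
    intro i j hij
    by_cases hi : i ∈ S <;> by_cases hj : j ∈ S
    · simp only [f, hi, hj, if_true] at hij
      exact hbij.injOn hi.1 hj.1 hij
    · simp only [f, hi, hj, if_true, if_false] at hij
      exact absurd (hij ▸ hSS i hi) hj
    · simp only [f, hi, hj, if_true, if_false] at hij
      exact absurd (hij ▸ hSS j hj) hi
    · simpa only [f, hi, hj, if_false] using hij
  obtain ⟨x, hx⟩ := hR
  have hit : ∀ k, h^[k] x ∈ R := by
    intro k
    induction k with
    | zero => exact hx
    | succ k ih => rw [Function.iterate_succ_apply']; exact hmaps _ ih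
  have hper : ∃ k, h^[k] x ∈ P := by
    obtain ⟨a, b, hab, he⟩ := Finite.exists_ne_map_eq_of_infinite fun k : ℕ => h^[k] x
    wlog hlt : a < b generalizing a b
    · exact this b a hab.symm he.symm (lt_of_le_of_ne (not_lt.1 hlt) hab.symm)
    refine ⟨a, Function.mem_periodicPts.2 ⟨b - a, by omega, ?_⟩⟩
    rw [Function.IsPeriodicPt, Function.IsFixedPt, ← Function.iterate_add_apply]
    rw [Nat.sub_add_cancel hlt.le]
    exact he.symm
  obtain ⟨k, hk⟩ := hper
  refine ⟨Equiv.ofBijective f (Finite.injective_iff_bijective.1 hinj), ?_, ?_⟩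
  · intro h1
    have h2 : f (h^[k] x) = h^[k] x := congrArg (fun σ : Equiv.Perm α => σ (h^[k] x)) h1
    have h3 : h^[k] x ∈ S := ⟨hk, hit k⟩
    simp only [f, h3, if_true] at h2
    exact hne _ (hit k) h2
  · intro i hi
    by_cases hiS : i ∈ S
    · exact ⟨hiS.2, by simp [f, hiS]⟩
    · simp [f, hiS] at hi

/-- Maximality depends on a multi-circuit of the graph only through its length and weight. -/
theorem MultiCircuit.IsMaximal.of_length_eq_weight_eq {B : Mat n} {lam : Rmax}
    {C C' : MultiCircuit n} (hC : C.IsMaximal B lam) (hG : C'.InGraph B)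
    (hl : C'.length = C.length) (hw : C'.weight B = C.weight B) : C'.IsMaximal B lam := by
  have key : ∀ l : ℝ, C.IsMaximalReal B l → C'.IsMaximalReal B l := fun l h =>
    ⟨hG, by rw [hl, hw]; exact h.2⟩
  rcases hC with ⟨l, h1, h2⟩ | ⟨h1, M, h2⟩
  · exact Or.inl ⟨l, h1, key l h2⟩
  · exact Or.inr ⟨h1, M, fun m hm => key m (h2 m hm)⟩

theorem MultiCircuit.IsMaximal.inGraph {B : Mat n} {lam : Rmax} {C : MultiCircuit n}
    (hC : C.IsMaximal B lam) : C.InGraph B := by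
  rcases hC with ⟨l, _, h⟩ | ⟨_, M, h⟩
  · exact h.1
  · exact (h M le_rfl).1

/-- If every vertex of a nonempty set `R` has a tight edge on a maximal multi-circuit `C` and a second
tight edge whose head is among the heads of those of `C`, then some exchange along tight edges
gives another maximal multi-circuit of the same length. -/
theorem not_exists_tight_exchange {B : Mat n} {lam : Rmax} (hB : DistinctLengths B)
    {C : MultiCircuit n} (hC : C.IsMaximal B lam) {R K : Finset (Fin n)} (hRV : R ⊆ C.verts)
    (hR : R.Nonempty) {x y : Vec n} {M : Rmax} (hM : M ≠ ⊥) (hK : K.card ≤ R.card)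
    (hRK : ∀ i ∈ R, C.succ i ∈ K)
    (htight : ∀ i ∈ R, y i + (B i (C.succ i) + x (C.succ i)) = M)
    (hsnd : ∀ i ∈ R, ∃ j ∈ K, j ≠ C.succ i ∧ y i + (B i j + x j) = M) : False := by
  classical
  -- The cardinality bound forces the heads of the second edges to be heads of edges of `C` starting
  -- in `R`, so they can be pulled back to `R`.
  have hKR : K = R.image C.succ := by
    refine (Finset.eq_of_subset_of_card_le (Finset.image_subset_iff.2 hRK) ?_).symm
    rwa [Finset.card_image_of_injective _ C.succ.injective]
  choose! g hgK hgne hg using hsnd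
  obtain ⟨σ, hσ1, hσ⟩ := exists_perm_of_mapsTo R hR (fun i => C.succ.symm (g i))
    (fun i hi => by
      have := hgK i hi
      rw [hKR, Finset.mem_image] at this
      obtain ⟨r, hr, he⟩ := this
      rw [← he]; simpa using hr)
    (fun i hi he => hgne i hi ((Equiv.symm_apply_eq _).1 he))
  have hσR : ∀ i, σ i ∈ R ↔ i ∈ R := by
    intro i
    by_cases h : σ i = i
    · rw [h]
    · have h1 : σ (σ i) ≠ σ i := fun h' => h (σ.injective h')
      simp [(hσ i h).1, (hσ _ h1).1]
  have hedge : ∀ i, i ∈ R → y i + (B i (C.succ (σ i)) + x (C.succ (σ i))) = M := by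
    intro i hi
    by_cases h : σ i = i
    · rw [h]; exact htight i hi
    · rw [(hσ i h).2]; simpa using hg i hi
  have hnb : ∀ i ∈ R, y i ≠ ⊥ ∧ B i (C.succ (σ i)) ≠ ⊥ ∧ x (C.succ i) ≠ ⊥ := by
    intro i hi
    have h1 := hedge i hi
    have h2 := htight i hi
    have h3 := h1 ▸ hM
    have h4 := h2 ▸ hM
    rw [WithBot.add_ne_bot, WithBot.add_ne_bot] at h3 h4
    exact ⟨h3.1, h3.2.1, h4.2.2⟩
  let C' : MultiCircuit n := ⟨C.verts, σ.trans C.succ, fun i hi => by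
    have : σ i = i := by
      by_contra h
      exact hi (hRV (hσ i h).1)
    simp [this, C.succ_eq_self i hi]⟩
  have hC'C : C ≠ C' := by
    intro h
    apply hσ1
    ext i
    have := congrArg (fun D : MultiCircuit n => D.succ i) h
    simp only [C', Equiv.trans_apply] at this
    rw [← C.succ.injective this]; rfl
  refine hB lam C C' hC (hC.of_length_eq_weight_eq ?_ rfl ?_) hC'C rfl
  · rintro i j ⟨hi, rfl⟩
    change B i (C.succ (σ i)) ≠ ⊥
    by_cases h : σ i = i
    · rw [h]; exact hC.inGraph i _ ⟨hi, rfl⟩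
    · exact (hnb i (hσ i h).1).2.1
  · have hsplit : ∀ f : Fin n → Rmax,
        ∑ i ∈ C.verts, f i = ∑ i ∈ C.verts \ R, f i + ∑ i ∈ R, f i :=
      fun f => (Finset.sum_sdiff hRV).symm
    change ∑ i ∈ C.verts, B i (C.succ (σ i)) = ∑ i ∈ C.verts, B i (C.succ i)
    rw [hsplit, hsplit]
    congr 1
    · refine Finset.sum_congr rfl fun i hi => ?_
      have : σ i = i := by
        by_contra h
        exact (Finset.mem_sdiff.1 hi).2 (hσ i h).1
      rw [this]
    · have hX : ∑ i ∈ R, x (C.succ i) ≠ ⊥ := by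
        rw [Ne, WithBot.sum_eq_bot_iff]
        rintro ⟨i, hi, h⟩
        exact (hnb i hi).2.2 h
      -- Tightness makes each weight b_ij a potential difference; the x-potentials are only permuted
      -- by σ, so adding their total to both sides and cancelling y_i row by row gives equal
      -- weights.
      refine WithBot.add_right_cancel hX ?_
      have hperm : ∑ i ∈ R, x (C.succ (σ i)) = ∑ i ∈ R, x (C.succ i) :=
        Finset.sum_equiv σ (fun i => (hσR i).symm) fun i _ => rfl
      conv_lhs => rw [← hperm]
      rw [← Finset.sum_add_distrib, ← Finset.sum_add_distrib]
      refine Finset.sum_congr rfl fun i hi => ?_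
      exact WithBot.add_left_cancel (hnb i hi).1 ((hedge i hi).trans (htight i hi).symm)

/-! ### The equations of a circuit space, row by row -/

theorem mulVec_sup_apply (P Q : Mat n) (x : Vec n) (i : Fin n) :
    mulVec (P ⊔ Q) x i = mulVec P x i ⊔ mulVec Q x i := by
  simp only [mulVec, Pi.sup_apply, ← Finset.sup_sup]
  refine Finset.sup_congr rfl fun j _ => ?_
  exact max_add_add_right _ _ _ |>.symm

theorem mulVec_smul_diagOn (lam : Rmax) (S : Finset (Fin n)) (x : Vec n) (i : Fin n) :
    mulVec (smul lam (diagOn S)) x i = if i ∈ S then lam + x i else ⊥ := by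
  apply le_antisymm
  · refine Finset.sup_le fun j _ => ?_
    by_cases h : i = j ∧ i ∈ S
    · obtain ⟨rfl, h⟩ := h
      simp [smul, diagOn, h]
    · simp [smul, diagOn, h]
  · split_ifs with h
    · refine le_trans ?_ (Finset.le_sup (Finset.mem_univ i))
      simp [smul, diagOn, h]
    · exact bot_le

theorem mulVec_matOn (B : Mat n) (C : MultiCircuit n) (x : Vec n) (i : Fin n) :
    mulVec (C.matOn B) x i = if i ∈ C.verts then B i (C.succ i) + x (C.succ i) else ⊥ := by
  apply le_antisymm
  · refine Finset.sup_le fun j _ => ?_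
    by_cases h : C.IsEdge i j
    · obtain ⟨h, rfl⟩ := h
      simp [MultiCircuit.matOn, MultiCircuit.IsEdge, h]
    · simp [MultiCircuit.matOn, h]
  · split_ifs with h
    · refine le_trans ?_ (Finset.le_sup (Finset.mem_univ (C.succ i)))
      simp [MultiCircuit.matOn, MultiCircuit.IsEdge, h]
    · exact bot_le

theorem le_mulVec_matOff (B : Mat n) (C : MultiCircuit n) (x : Vec n) {i j : Fin n}
    (h : ¬ C.IsEdge i j) : B i j + x j ≤ mulVec (C.matOff B) x i := by
  refine le_trans ?_ (Finset.le_sup (Finset.mem_univ j))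
  simp [MultiCircuit.matOff, h]

theorem exists_eq_mulVec_matOff (B : Mat n) (C : MultiCircuit n) (x : Vec n) (i : Fin n)
    (h : mulVec (C.matOff B) x i ≠ ⊥) :
    ∃ j, ¬ C.IsEdge i j ∧ B i j + x j = mulVec (C.matOff B) x i := by
  obtain ⟨j, _, hj⟩ := Finset.exists_mem_eq_sup Finset.univ ⟨i, Finset.mem_univ i⟩
    fun j => C.matOff B i j + x j
  change mulVec (C.matOff B) x i = _ at hj
  by_cases he : C.IsEdge i j
  · simp [MultiCircuit.matOff, he] at hj
    exact absurd hj h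
  · refine ⟨j, he, ?_⟩
    simp [hj, MultiCircuit.matOff, he]

/-- The equation of `circuitSpace` in a row on the multi-circuit. -/
theorem eq_of_mem_circuitSpace {B : Mat n} {lam : Rmax} {C : MultiCircuit n} {x : Vec n}
    (hx : x ∈ circuitSpace B lam C) {i : Fin n} (hi : i ∈ C.verts) :
    mulVec (C.matOff B) x i ⊔ (lam + x i) = B i (C.succ i) + x (C.succ i) := by
  have h := congrFun hx i
  rw [mulVec_sup_apply, mulVec_sup_apply, mulVec_smul_diagOn, mulVec_smul_diagOn,
    mulVec_matOn] at h
  simpa [hi] using h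

/-- The equation of `circuitSpace` in a row off the multi-circuit. -/
theorem eq_of_mem_circuitSpace_of_notMem {B : Mat n} {lam : Rmax} {C : MultiCircuit n} {x : Vec n}
    (hx : x ∈ circuitSpace B lam C) {i : Fin n} (hi : i ∉ C.verts) :
    mulVec (C.matOff B) x i = lam + x i := by
  have h := congrFun hx i
  rw [mulVec_sup_apply, mulVec_sup_apply, mulVec_smul_diagOn, mulVec_smul_diagOn,
    mulVec_matOn] at h
  simpa [hi] using h

theorem exists_ge_of_mem_circuitSpace {B : Mat n} {lam : Rmax} {C : MultiCircuit n} {x : Vec n}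
    (hx : x ∈ circuitSpace B lam C) {i : Fin n} (hi : lam + x i ≠ ⊥) :
    ∃ j, lam + x i ≤ B i j + x j := by
  by_cases hC : i ∈ C.verts
  · exact ⟨C.succ i, by rw [← eq_of_mem_circuitSpace hx hC]; exact le_sup_right⟩
  · rw [← eq_of_mem_circuitSpace_of_notMem hx hC] at hi ⊢
    obtain ⟨j, _, hj⟩ := exists_eq_mulVec_matOff B C x i hi
    exact ⟨j, hj.ge⟩

/-- In a row whose maximal entry exceeds the diagonal term, the maximum is attained on the
multi-circuit and at least once more. -/
theorem tight_of_mem_circuitSpace {B : Mat n} {lam : Rmax} {C : MultiCircuit n} {x : Vec n}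
    (hx : x ∈ circuitSpace B lam C) {i j : Fin n} {a M : Rmax}
    (hij : a + (B i j + x j) = M) (hle : ∀ k, a + (B i k + x k) ≤ M)
    (hlt : a + (lam + x i) < M) :
    i ∈ C.verts ∧ a + (B i (C.succ i) + x (C.succ i)) = M ∧
      ∃ k, k ≠ C.succ i ∧ a + (B i k + x k) = M := by
  have hM : M ≠ ⊥ := ne_bot_of_gt hlt
  have ha : a ≠ ⊥ := by
    rintro rfl
    simp at hij
    exact hM hij.symm
  have hiC : i ∈ C.verts := by
    by_contra hiC
    rw [← eq_of_mem_circuitSpace_of_notMem hx hiC] at hlt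
    have h1 := le_mulVec_matOff B C x (i := i) (j := j) fun h => hiC h.1
    have h2 : M ≤ a + mulVec (C.matOff B) x i := hij ▸ add_le_add_right h1 a
    exact absurd hlt (not_lt.2 h2)
  have heq := eq_of_mem_circuitSpace hx hiC
  have htight : a + (B i (C.succ i) + x (C.succ i)) = M := by
    by_cases hj : j = C.succ i
    · rw [← hj]; exact hij
    · have h1 := le_mulVec_matOff B C x (i := i) (j := j) fun h => hj h.2.symm
      refine le_antisymm (hle _) ?_
      rw [← heq, ← hij]
      exact add_le_add_right (h1.trans le_sup_left) a
  refine ⟨hiC, htight, ?_⟩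
  have hoff : a + mulVec (C.matOff B) x i = M := by
    rw [← heq] at htight
    rcases max_choice (mulVec (C.matOff B) x i) (lam + x i) with h | h
    · rwa [h] at htight
    · rw [h] at htight
      exact absurd htight hlt.ne
  have hnb : mulVec (C.matOff B) x i ≠ ⊥ := fun h => by
    rw [h, WithBot.add_bot] at hoff
    exact hM hoff.symm
  obtain ⟨k, hk, hk'⟩ := exists_eq_mulVec_matOff B C x i hnb
  exact ⟨k, fun h => hk ⟨hiC, h.symm⟩, by rw [hk', hoff]⟩

/-! ### Biorthogonality of right and left eigenvectors -/

/-- No term of `⨁ᵢ xᵢ ⊗ yᵢ` other than `ε` strictly exceeds all others. -/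
def NoStrictMax (x y : Vec n) : Prop :=
  ∀ i, x i + y i ≠ ⊥ → ∃ j, j ≠ i ∧ x i + y i ≤ x j + y j

theorem NoStrictMax.symm {x y : Vec n} (h : NoStrictMax x y) : NoStrictMax y x := by
  intro i hi
  rw [add_comm] at hi
  obtain ⟨j, hj, hle⟩ := h i hi
  exact ⟨j, hj, by rwa [add_comm (y i), add_comm (y j)]⟩

/-- Right and left eigenvectors for distinct parameters are orthogonal. -/
theorem noStrictMax_of_lt {B : Mat n} (hB : DistinctLengths B)
    (hB' : DistinctLengths fun i j => B j i) {lam mu : Rmax} (hlt : mu < lam)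
    {C D : MultiCircuit n} (hC : C.IsMaximal B lam) (hD : D.IsMaximal (fun i j => B j i) mu)
    {x y : Vec n} (hx : x ∈ circuitSpace B lam C)
    (hy : y ∈ circuitSpace (fun i j => B j i) mu D) : NoStrictMax x y := by
  classical
  intro i₀ hi₀
  by_contra! hcon
  have hlam : lam ≠ ⊥ := ne_bot_of_gt hlt
  have hs : y i₀ ≠ ⊥ ∧ lam + x i₀ ≠ ⊥ := by
    rw [WithBot.add_ne_bot] at hi₀ ⊢
    exact ⟨hi₀.2, hlam, hi₀.1⟩
  let T : Fin n → Fin n → Rmax := fun i j => y i + (B i j + x j)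
  have hT : ∀ i j, T i j = x j + (B i j + y i) := fun i j => by
    simp only [T]; ac_rfl
  obtain ⟨⟨p, q⟩, -, hpq⟩ := Finset.exists_max_image Finset.univ
    (fun e : Fin n × Fin n => T e.1 e.2) ⟨(i₀, i₀), Finset.mem_univ _⟩
  set M := T p q with hMdef
  have hmax : ∀ i j, T i j ≤ M := fun i j => hpq (i, j) (Finset.mem_univ _)
  obtain ⟨j₀, hj₀⟩ := exists_ge_of_mem_circuitSpace hx hs.2
  have hMs : lam + (x i₀ + y i₀) ≤ M := by
    refine le_trans (le_trans (le_of_eq ?_) (add_le_add_right hj₀ (y i₀))) (hmax i₀ j₀)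
    ac_rfl
  have hM : M ≠ ⊥ := by
    refine ne_bot_of_le_ne_bot ?_ hMs
    rw [WithBot.add_ne_bot]; exact ⟨hlam, hi₀⟩
  -- Row i₀ must be exempted, since its diagonal term may equal M. No column needs exemption,
  -- because μ < λ.
  have hrow : ∀ i, i ≠ i₀ → y i + (lam + x i) < M := by
    intro i hi
    refine lt_of_lt_of_le ?_ hMs
    have := (WithBot.add_lt_add_iff_left hlam).2 (hcon i hi)
    refine lt_of_eq_of_lt ?_ this
    ac_rfl
  have hcol : ∀ j, x j + (mu + y j) < M := by
    intro j
    refine lt_of_lt_of_le ?_ hMs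
    have h1 : x j + y j ≤ x i₀ + y i₀ := by
      by_cases hj : j = i₀
      · rw [hj]
      · exact (hcon j hj).le
    have h2 : mu + (x i₀ + y i₀) < lam + (x i₀ + y i₀) := (WithBot.add_lt_add_iff_right hi₀).2 hlt
    refine lt_of_eq_of_lt ?_ (lt_of_le_of_lt (add_le_add_right h1 mu) h2)
    ac_rfl
  let rows : Finset (Fin n) := Finset.univ.filter fun i => ∃ j, T i j = M
  let cols : Finset (Fin n) := Finset.univ.filter fun j => ∃ i, T i j = M
  have hmr : ∀ {i j}, T i j = M → i ∈ rows := fun {i j} h =>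
    Finset.mem_filter.2 ⟨Finset.mem_univ _, j, h⟩
  have hmc : ∀ {i j}, T i j = M → j ∈ cols := fun {i j} h =>
    Finset.mem_filter.2 ⟨Finset.mem_univ _, i, h⟩
  have hq : q ∈ cols := hmc hMdef.symm
  have hrows : ∀ i ∈ rows.erase i₀, i ∈ C.verts ∧ T i (C.succ i) = M ∧
      ∃ k, k ≠ C.succ i ∧ T i k = M := by
    intro i hi
    obtain ⟨hne, hi⟩ := Finset.mem_erase.1 hi
    obtain ⟨j, hj⟩ := (Finset.mem_filter.1 hi).2
    exact tight_of_mem_circuitSpace hx hj (hmax i) (hrow i hne)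
  have hcols : ∀ j ∈ cols, j ∈ D.verts ∧ T (D.succ j) j = M ∧
      ∃ k, k ≠ D.succ j ∧ T k j = M := by
    intro j hj
    obtain ⟨i, hi⟩ := (Finset.mem_filter.1 hj).2
    have := tight_of_mem_circuitSpace hy (i := j) (j := i) (a := x j) (M := M) (by rw [← hT, hi])
      (fun k => by rw [← hT]; exact hmax k j) (hcol j)
    simpa only [hT] using this
  -- The exchange needs at least as many usable tails as heads: with no excess of rows it runs on
  -- the columns along `D`, otherwise on the rows along `C`, where the excess pays for dropping i₀.
  by_cases hcard : rows.card ≤ cols.card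
  · refine not_exists_tight_exchange hB' hD (R := cols) (K := rows) (x := y) (y := x)
      (fun j hj => (hcols j hj).1) ⟨q, hq⟩ hM hcard (fun j hj => hmr (hcols j hj).2.1)
      (fun j hj => ?_) (fun j hj => ?_)
    · rw [← hT]; exact (hcols j hj).2.1
    · obtain ⟨-, -, k, hk, hk'⟩ := hcols j hj
      exact ⟨k, hmr hk', hk, by rw [← hT, hk']⟩
  · have hcard' : cols.card ≤ (rows.erase i₀).card := by
      have := Finset.pred_card_le_card_erase (s := rows) (a := i₀)
      omega
    refine not_exists_tight_exchange hB hC (R := rows.erase i₀) (K := cols) (x := x) (y := y)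
      (fun j hj => (hrows j hj).1) ?_ hM hcard' (fun j hj => hmc (hrows j hj).2.1)
      (fun j hj => (hrows j hj).2.1) (fun j hj => ?_)
    · exact Finset.card_pos.1 (lt_of_lt_of_le (Finset.card_pos.2 ⟨q, hq⟩) hcard')
    · obtain ⟨-, -, k, hk, hk'⟩ := hrows j hj
      exact ⟨k, hmc hk', hk, hk'⟩

/-- Transposing `B` exchanges the roles of x and y, and so of the two parameters. -/
theorem noStrictMax_of_ne {B : Mat n} (hB : DistinctLengths B)
    (hB' : DistinctLengths fun i j => B j i) {lam mu : Rmax} (hne : lam ≠ mu)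
    {C D : MultiCircuit n} (hC : C.IsMaximal B lam) (hD : D.IsMaximal (fun i j => B j i) mu)
    {x y : Vec n} (hx : x ∈ circuitSpace B lam C)
    (hy : y ∈ circuitSpace (fun i j => B j i) mu D) : NoStrictMax x y := by
  rcases lt_or_gt_of_ne hne with h | h
  · exact (noStrictMax_of_lt hB' hB h hD hC hy hx).symm
  · exact noStrictMax_of_lt hB hB' h hC hD hx hy

/-! ### Passage to sums, limits and nonzero vectors -/

/-- At a given index each sum is attained by a single summand, and the competing index for that pair
also competes for the sums. Empty sums are harmless because terms equal to ε are exempt. -/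
theorem NoStrictMax.finsetSup {ι κ : Type*} {s : Finset ι} {t : Finset κ} {v : ι → Vec n}
    {w : κ → Vec n} (h : ∀ a ∈ s, ∀ b ∈ t, NoStrictMax (v a) (w b)) :
    NoStrictMax (s.sup v) (t.sup w) := by
  intro i hi
  rw [Finset.sup_apply, Finset.sup_apply] at hi
  have hi' := WithBot.add_ne_bot.1 hi
  have hs : s.Nonempty := by
    rw [Finset.nonempty_iff_ne_empty]; rintro rfl; simp at hi'
  have ht : t.Nonempty := by
    rw [Finset.nonempty_iff_ne_empty]; rintro rfl; simp at hi'
  obtain ⟨a, ha, hva⟩ := Finset.exists_mem_eq_sup s hs fun a => v a i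
  obtain ⟨b, hb, hwb⟩ := Finset.exists_mem_eq_sup t ht fun b => w b i
  rw [hva, hwb] at hi
  obtain ⟨j, hj, hle⟩ := h a ha b hb i hi
  refine ⟨j, hj, ?_⟩
  simp only [Finset.sup_apply]
  rw [hva, hwb]
  exact hle.trans (add_le_add (Finset.le_sup (f := fun a => v a j) ha)
    (Finset.le_sup (f := fun b => w b j) hb))

/-- Strict inequality between sums is witnessed by real bounds on the summands. -/
theorem exists_real_bounds_of_add_lt_add {a b c d : Rmax} (h : a + b < c + d) :
    ∃ a' b' c' d' : ℝ, a < a' ∧ b < b' ∧ (c' : Rmax) < c ∧ (d' : Rmax) < d ∧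
      a' + b' ≤ c' + d' := by
  have hcd := WithBot.add_ne_bot.1 (ne_bot_of_gt h)
  obtain ⟨c, rfl⟩ := WithBot.ne_bot_iff_exists.1 hcd.1
  obtain ⟨d, rfl⟩ := WithBot.ne_bot_iff_exists.1 hcd.2
  simp only [WithBot.coe_lt_coe]
  induction a using WithBot.recBotCoe with
  | bot =>
    induction b using WithBot.recBotCoe with
    | bot => exact ⟨c - 1 + (d - 1), 0, c - 1, d - 1, WithBot.bot_lt_coe _, WithBot.bot_lt_coe _,
        by linarith, by linarith, by linarith⟩
    -- Any real bounds ε from above, so the bound for the ε summand is chosen to make the final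
    -- inequality an equality.
    | coe b => exact ⟨c - 1 + (d - 1) - (b + 1), b + 1, c - 1, d - 1, WithBot.bot_lt_coe _,
        WithBot.coe_lt_coe.2 (by linarith), by linarith, by linarith, by linarith⟩
  | coe a =>
    induction b using WithBot.recBotCoe with
    | bot => exact ⟨a + 1, c - 1 + (d - 1) - (a + 1), c - 1, d - 1,
        WithBot.coe_lt_coe.2 (by linarith), WithBot.bot_lt_coe _, by linarith, by linarith,
        by linarith⟩
    | coe b =>
      have h' : a + b < c + d := by exact_mod_cast h
      refine ⟨a + (c + d - a - b) / 4, b + (c + d - a - b) / 4, c - (c + d - a - b) / 4,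
        d - (c + d - a - b) / 4, WithBot.coe_lt_coe.2 ?_, WithBot.coe_lt_coe.2 ?_, ?_, ?_, ?_⟩ <;>
      linarith

/-- A strict maximum different from ε amounts to finitely many strict inequalities, which would
persist near the limit. -/
theorem NoStrictMax.of_tendsto {ι : Type*} {l : Filter ι} [l.NeBot] {u v : ι → Vec n}
    {x y : Vec n} (hu : Tendsto u l (𝓝 x)) (hv : Tendsto v l (𝓝 y))
    (h : ∀ᶠ δ in l, NoStrictMax (u δ) (v δ)) : NoStrictMax x y := by
  intro i hi
  by_contra! hcon
  rw [tendsto_pi_nhds] at hu hv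
  have key : ∀ {j}, x j + y j < x i + y i → ∀ᶠ δ in l, u δ j + v δ j < u δ i + v δ i := by
    intro j hj
    obtain ⟨a, b, c, d, ha, hb, hc, hd, hle⟩ := exists_real_bounds_of_add_lt_add hj
    filter_upwards [(hu j).eventually_lt_const ha, (hv j).eventually_lt_const hb,
      (hu i).eventually_const_lt hc, (hv i).eventually_const_lt hd] with δ h1 h2 h3 h4
    calc u δ j + v δ j ≤ (a : Rmax) + b := add_le_add h1.le h2.le
      _ ≤ (c : Rmax) + d := by exact_mod_cast hle
      _ ≤ (c : Rmax) + v δ i := add_le_add_right h4.le _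
      _ < u δ i + v δ i := (WithBot.add_lt_add_iff_right (ne_bot_of_gt h4)).2 h3
  have hall : ∀ᶠ δ in l, ∀ j, j ≠ i → u δ j + v δ j < u δ i + v δ i := by
    rw [eventually_all]
    intro j
    by_cases hj : j = i
    · simp [hj]
    · filter_upwards [key (hcon j hj)] with δ hδ _ using hδ
  have hnb : ∀ᶠ δ in l, u δ i + v δ i ≠ ⊥ := by
    rw [WithBot.add_ne_bot] at hi
    filter_upwards [(hu i).eventually_const_lt (bot_lt_iff_ne_bot.2 hi.1),
      (hv i).eventually_const_lt (bot_lt_iff_ne_bot.2 hi.2)] with δ h1 h2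
    rw [WithBot.add_ne_bot]
    exact ⟨ne_bot_of_gt h1, ne_bot_of_gt h2⟩
  obtain ⟨δ, h1, h2, h3⟩ := (hall.and (hnb.and h)).exists
  obtain ⟨j, hj, hle⟩ := h3 i h2
  exact absurd (h1 j hj) (not_lt.2 hle)

theorem NoStrictMax.orthogonal {x y : Vec n} (h : NoStrictMax x y) (hx : x ≠ ⊥) (hy : y ≠ ⊥) :
    Orthogonal x y := by
  obtain ⟨a, ha⟩ := Function.ne_iff.1 hx
  obtain ⟨b, hb⟩ := Function.ne_iff.1 hy
  obtain ⟨i, -, hi⟩ := Finset.exists_max_image Finset.univ (fun i => x i + y i)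
    ⟨a, Finset.mem_univ a⟩
  by_cases hbot : x i + y i = ⊥
  -- If all terms are ε, any two indices will do; positions of nonzero entries of x and y provide
  -- them, being necessarily distinct.
  · have hle : ∀ j k, x k + y k ≤ x j + y j := fun j k =>
      (hi k (Finset.mem_univ k)).trans (hbot ▸ bot_le)
    by_cases hab : a = b
    · subst hab
      have := hi a (Finset.mem_univ a)
      rw [hbot, le_bot_iff] at this
      exact absurd this (WithBot.add_ne_bot.2 ⟨ha, hb⟩)
    · exact ⟨a, b, hab, hle a, hle b⟩
  · obtain ⟨j, hj, hle⟩ := h i hbot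
    exact ⟨i, j, hj.symm, fun k => hi k (Finset.mem_univ k),
      fun k => (hi k (Finset.mem_univ k)).trans hle⟩

/-! ### Generic perturbation directions -/

instance : Finite (MultiCircuit n) :=
  Finite.of_injective (fun C : MultiCircuit n => (C.verts, C.succ)) fun C C' h => by
    obtain ⟨h1, h2⟩ := Prod.mk.inj h
    exact MultiCircuit.ext h1 h2

/-- The sum of the entries of a real matrix along a multi-circuit. -/
def edgeSum (ζ : Fin n → Fin n → ℝ) (C : MultiCircuit n) : ℝ := ∑ i ∈ C.verts, ζ i (C.succ i)

theorem MultiCircuit.eq_of_isEdge_iff {C C' : MultiCircuit n}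
    (h : ∀ i j, C.IsEdge i j ↔ C'.IsEdge i j) : C = C' := by
  have hv : C.verts = C'.verts := by
    ext i
    exact ⟨fun hi => ((h i (C.succ i)).1 ⟨hi, rfl⟩).1, fun hi => ((h i (C'.succ i)).2 ⟨hi, rfl⟩).1⟩
  refine MultiCircuit.ext hv (Equiv.ext fun i => ?_)
  by_cases hi : i ∈ C.verts
  · exact (((h i (C.succ i)).1 ⟨hi, rfl⟩).2).symm
  · rw [C.succ_eq_self i hi, C'.succ_eq_self i (hv ▸ hi)]

/-- With distinct powers of two as entries, a multi-circuit is determined by its edge sum. -/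
theorem edgeSum_two_pow_injective {f : Fin n → Fin n → ℕ}
    (hf : ∀ i j i' j', f i j = f i' j' → i = i' ∧ j = j') {c : ℝ} (hc : c ≠ 0) :
    Function.Injective (edgeSum fun i j => (2 : ℝ) ^ f i j / c) := by
  intro C C' h
  have hinj : ∀ D : MultiCircuit n, Set.InjOn (fun i => f i (D.succ i)) D.verts :=
    fun D i _ j _ hij => (hf _ _ _ _ hij).1
  have hsum : ∀ D : MultiCircuit n, edgeSum (fun i j => (2 : ℝ) ^ f i j / c) D =
      ((∑ k ∈ D.verts.image fun i => f i (D.succ i), 2 ^ k : ℕ) : ℝ) / c := by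
    intro D
    rw [Finset.sum_image (hinj D), edgeSum, ← Finset.sum_div]
    push_cast
    rfl
  rw [hsum, hsum, div_left_inj' hc, Nat.cast_inj] at h
  -- Uniqueness of binary expansions recovers the set of edge labels.
  have himg := Finset.geomSum_injective le_rfl h
  have hmem : ∀ (D : MultiCircuit n) i j,
      D.IsEdge i j ↔ f i j ∈ D.verts.image fun i => f i (D.succ i) := by
    intro D i j
    rw [Finset.mem_image]
    constructor
    · rintro ⟨hi, rfl⟩
      exact ⟨i, hi, rfl⟩
    · rintro ⟨k, hk, he⟩
      obtain ⟨rfl, rfl⟩ := hf _ _ _ _ he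
      exact ⟨hk, rfl⟩
  exact MultiCircuit.eq_of_isEdge_iff fun i j => by rw [hmem, hmem, himg]

theorem perturb_ne_bot {A : Mat n} {ζ : Fin n → Fin n → ℝ} {δ : ℝ} {i j : Fin n} :
    perturb A ζ δ i j ≠ ⊥ ↔ A i j ≠ ⊥ := by
  simp [perturb]

/-- The weight is affine in δ with slope `-edgeSum ζ C`. The default value 0 is never used, as all
edges lie in G(A). -/
theorem weight_perturb {A : Mat n} (ζ : Fin n → Fin n → ℝ) (δ : ℝ) {C : MultiCircuit n}
    (hC : C.InGraph A) : C.weight (perturb A ζ δ) =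
      ((edgeSum (fun i j => (A i j).unbotD 0) C - edgeSum ζ C * δ : ℝ) : Rmax) := by
  have h : ∀ i ∈ C.verts, perturb A ζ δ i (C.succ i) =
      (((A i (C.succ i)).unbotD 0 - ζ i (C.succ i) * δ : ℝ) : Rmax) := by
    intro i hi
    obtain ⟨a, ha⟩ := WithBot.ne_bot_iff_exists.1 (hC i _ ⟨hi, rfl⟩)
    rw [perturb, ← ha, WithBot.unbotD_coe, ← WithBot.coe_add, sub_eq_add_neg]
  rw [MultiCircuit.weight, Finset.sum_congr rfl h, ← WithBot.coe_sum, edgeSum, edgeSum,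
    Finset.sum_mul, Finset.sum_sub_distrib]

theorem weight_eq_of_isMaximal {B : Mat n} {lam : Rmax} {C C' : MultiCircuit n}
    (hC : C.IsMaximal B lam) (hC' : C'.IsMaximal B lam) (hl : C.length = C'.length) :
    C.weight B = C'.weight B := by
  have key : ∀ l : ℝ, C.IsMaximalReal B l → C'.IsMaximalReal B l →
      C.weight B = C'.weight B := by
    intro l h h'
    have he := h.2.symm.trans h'.2
    rw [hl] at he
    refine WithBot.add_right_cancel ?_ he
    rw [← WithBot.coe_nsmul]
    exact WithBot.coe_ne_bot
  rcases hC with ⟨l, h1, h2⟩ | ⟨h1, M, h2⟩ <;> rcases hC' with ⟨l', h1', h2'⟩ | ⟨h1', M', h2'⟩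
  · rw [h1, WithBot.coe_inj] at h1'
    subst h1'
    exact key l h2 h2'
  · exact absurd (h1.symm.trans h1') WithBot.coe_ne_bot
  · exact absurd (h1'.symm.trans h1) WithBot.coe_ne_bot
  · exact key (min M M') (h2 _ (min_le_left _ _)) (h2' _ (min_le_right _ _))

/-- Perturbed weights of distinct multi-circuits are affine in δ with different slopes, so each pair
agrees for at most one δ. There are finitely many pairs, so none agrees for small δ > 0, whereas
maximal multi-circuits of equal length have equal weight. -/
theorem mem_admissible_of_edgeSum_injective (A : Mat n) {ζ : Fin n → Fin n → ℝ}
    (hζ : ∀ i j, ζ i j ∈ Set.Icc (0 : ℝ) 1) (hinj : Function.Injective (edgeSum ζ)) :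
    ζ ∈ admissible A := by
  refine ⟨hζ, ?_⟩
  let a : MultiCircuit n → ℝ := edgeSum fun i j => (A i j).unbotD 0
  have hev : ∀ᶠ δ : ℝ in 𝓝[>] 0, ∀ C C' : MultiCircuit n, C ≠ C' →
      a C - edgeSum ζ C * δ ≠ a C' - edgeSum ζ C' * δ := by
    rw [eventually_all]
    intro C
    rw [eventually_all]
    intro C'
    by_cases hCC : C = C'
    · simp [hCC]
    have hs : edgeSum ζ C - edgeSum ζ C' ≠ 0 := sub_ne_zero.2 fun h => hCC (hinj h)
    have hne : ∀ᶠ δ : ℝ in 𝓝[>] 0, δ ≠ (a C - a C') / (edgeSum ζ C - edgeSum ζ C') := by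
      by_cases h0 : (a C - a C') / (edgeSum ζ C - edgeSum ζ C') = 0
      · rw [h0]
        filter_upwards [self_mem_nhdsWithin] with δ hδ using (Set.mem_Ioi.1 hδ).ne'
      · exact (eventually_ne_nhds (Ne.symm h0)).filter_mono nhdsWithin_le_nhds
    filter_upwards [hne] with δ hδ _ he
    apply hδ
    rw [eq_div_iff hs]
    linarith
  obtain ⟨δ', hδ', h⟩ := mem_nhdsGT_iff_exists_Ioo_subset.1 hev
  refine ⟨δ', hδ', fun δ h0 h1 lam C C' hC hC' hne hl => ?_⟩
  have hG : ∀ {D : MultiCircuit n}, D.IsMaximal (perturb A ζ δ) lam → D.InGraph A :=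
    fun hD i j hij => perturb_ne_bot.1 (hD.inGraph i j hij)
  have hw := weight_eq_of_isMaximal hC hC' hl
  rw [weight_perturb ζ δ (hG hC), weight_perturb ζ δ (hG hC'), WithBot.coe_inj] at hw
  exact h ⟨h0, h1⟩ C C' hne hw

/-- Number the n² positions and use the corresponding powers of two, scaled into [0,1]; transposing
merely renumbers the positions. -/
theorem exists_admissible (A : Mat n) :
    ∃ ζ : Fin n → Fin n → ℝ, ζ ∈ admissible A ∧ (fun i j => ζ j i) ∈ admissible A := by
  let f : Fin n → Fin n → ℕ := fun i j => (finProdFinEquiv (i, j) : Fin (n * n))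
  have hf : ∀ i j i' j', f i j = f i' j' → i = i' ∧ j = j' := fun i j i' j' h =>
    Prod.mk.inj (finProdFinEquiv.injective (Fin.ext h))
  have hc : (2 : ℝ) ^ (n * n) ≠ 0 := by positivity
  have hI : ∀ i j, (2 : ℝ) ^ f i j / 2 ^ (n * n) ∈ Set.Icc (0 : ℝ) 1 := by
    intro i j
    refine ⟨by positivity, div_le_one_of_le₀ ?_ (by positivity)⟩
    exact pow_le_pow_right₀ one_le_two (finProdFinEquiv (i, j)).isLt.le
  refine ⟨fun i j => (2 : ℝ) ^ f i j / 2 ^ (n * n),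
    mem_admissible_of_edgeSum_injective A hI (edgeSum_two_pow_injective hf hc),
    mem_admissible_of_edgeSum_injective A (fun i j => hI j i)
      (edgeSum_two_pow_injective (f := fun i j => f j i) ?_ hc)⟩
  intro i j i' j' h
  exact (hf _ _ _ _ h).symm

/-! ### Separating the parameters and assembling the proof -/

theorem eventually_disjoint_closedInterval {lam mu : Rmax} (hne : lam ≠ mu) (k : ℝ) :
    ∀ᶠ δ : ℝ in 𝓝[>] 0, ∀ a ∈ closedInterval lam (k * δ), ∀ b ∈ closedInterval mu (k * δ),
      a ≠ b := by
  by_cases hreal : lam ≠ ⊥ ∧ mu ≠ ⊥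
  · obtain ⟨l, rfl⟩ := WithBot.ne_bot_iff_exists.1 hreal.1
    obtain ⟨m, rfl⟩ := WithBot.ne_bot_iff_exists.1 hreal.2
    -- Two real intervals of radius kδ can meet only if the distance of their centres is at most
    -- 2kδ.
    have hlm : 0 < |l - m| := abs_pos.2 (sub_ne_zero.2 fun h => hne (by rw [h]))
    have hlim : Tendsto (fun δ : ℝ => 2 * (k * δ)) (𝓝[>] 0) (𝓝 0) := by
      have : Continuous fun δ : ℝ => 2 * (k * δ) := by fun_prop
      simpa using (this.tendsto 0).mono_left nhdsWithin_le_nhds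
    filter_upwards [hlim.eventually_lt_const hlm] with δ hδ
    rintro a (⟨h, -⟩ | ⟨l', a', h1, rfl, ha⟩) b (⟨h, -⟩ | ⟨m', b', h2, rfl, hb⟩) hab
    · exact WithBot.coe_ne_bot h
    · exact WithBot.coe_ne_bot h
    · exact WithBot.coe_ne_bot h
    · rw [WithBot.coe_inj] at h1 h2 hab
      subst h1 h2 hab
      have h3 := ha.1
      have h4 := ha.2
      have h5 := hb.1
      have h6 := hb.2
      rcases abs_cases (l - m) with h | h <;> linarith
  · refine Eventually.of_forall fun δ => ?_
    rintro a (⟨h1, rfl⟩ | ⟨l, a', h1, rfl, -⟩) b (⟨h2, rfl⟩ | ⟨m, b', h2, rfl, -⟩)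
    · exact absurd (h1.trans h2.symm) hne
    · exact WithBot.bot_ne_coe
    · exact WithBot.coe_ne_bot
    · exact absurd ⟨h1 ▸ WithBot.coe_ne_bot, h2 ▸ WithBot.coe_ne_bot⟩ hreal

theorem perturb_transpose {A : Mat n} (hA : ∀ i j, A i j = A j i) (ζ : Fin n → Fin n → ℝ) (δ : ℝ) :
    perturb A (fun i j => ζ j i) δ = fun i j => perturb A ζ δ j i := by
  funext i j
  rw [perturb, perturb, hA i j]

theorem noStrictMax_of_mem_algEigenspace {A : Mat n} (hA : ∀ i j, A i j = A j i) {lam mu : Rmax}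
    (hne : lam ≠ mu) {x y : Vec n} (hx : x ∈ algEigenspace A lam) (hy : y ∈ algEigenspace A mu) :
    NoStrictMax x y := by
  obtain ⟨ζ, hζ, hζ'⟩ := exists_admissible A
  obtain ⟨u, hu, hux⟩ := Set.mem_iInter₂.1 hx ζ hζ
  obtain ⟨v, hv, hvy⟩ := Set.mem_iInter₂.1 hy _ hζ'
  refine NoStrictMax.of_tendsto hux hvy ?_
  obtain ⟨-, d, hd, hB⟩ := hζ
  obtain ⟨-, d', hd', hB'⟩ := hζ'
  filter_upwards [Ioo_mem_nhdsGT hd, Ioo_mem_nhdsGT hd',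
    eventually_disjoint_closedInterval hne n] with δ h1 h2 h3
  obtain ⟨s, p, hp, hup⟩ := hu δ h1.1
  obtain ⟨t, q, hq, hvq⟩ := hv δ h1.1
  have hD := hB δ h1.1 h1.2
  have hD' := hB' δ h2.1 h2.2
  rw [hup, hvq]
  rw [perturb_transpose hA] at hD' hq
  refine NoStrictMax.finsetSup fun a ha b hb => ?_
  obtain ⟨hal, C, hC, hpC⟩ := hp a ha
  obtain ⟨hbm, D, hD₁, hqD⟩ := hq b hb
  exact noStrictMax_of_ne hD hD' (h3 a hal b hbm) hC hD₁ hpC hqD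

end MaxPlus

theorem mainTheorem2 (n : ℕ) (A : MaxPlus.Mat n) (hA : ∀ i j, A i j = A j i)
    (lam mu : MaxPlus.Rmax)
    (hlam : MaxPlus.IsAlgEigenvalue A lam) (hmu : MaxPlus.IsAlgEigenvalue A mu) (hne : lam ≠ mu)
    (x y : MaxPlus.Vec n)
    (hx : MaxPlus.IsAlgEigenvector A lam x) (hy : MaxPlus.IsAlgEigenvector A mu y) :
    MaxPlus.Orthogonal x y :=
  (MaxPlus.noStrictMax_of_mem_algEigenspace hA hne hx.1 hy.1).orthogonal hx.2 hy.2
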